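/- For a binary relation $T$ on a set $X$ let $\overline{T}=T\cup T^{-1}$, and for relations $T,U$ on $X$ let $T\circ U=\{(x,z) : x\,T\,y \text{ and } y\,U\,z \text{ for some } y\in X\}$. Let $\mathcal{F}_{2,1}(X)$ be the set of ordered pairs $(S,R)$ of binary relations on $X$ such that 1. $S$ and $R$ are strict orders (irreflexive and transitive); 2. $\overline{R}\cup\overline{S}=X^2\setminus\{(x,x) : x\in X\}$; 3. $\overline{R}\cap\overline{S}=\emptyset$; 4. $S\circ S\circ R\subseteq R$. Two pairs $(S,R)$ and $(S',R')$ on $X$ are isomorphic if there is a bijection $\xi:X\to X$ such that, for all $x,y\in X$, $x\,S\,y\iff \xi(x)\,S'\,\xi(y)$ and $x\,R\,y\iff\xi(x)\,R'\,\xi(y)$. Let $n\ge 1$ and let $X$ be a set with $n$ elements. Then the number of isomorphism classes of pairs in $\mathcal{F}_{2,1}(X)$ is the $n$-th term of the sequence $1,2,6,22,90,\ldots$ of large Schröder numbers, that is, it equals $r_{n-1}$, where $r_0=1$ and $r_{m+1}=r_m+\sum_{i=0}^{m} r_i\,r_{m-i}$ for $m\ge 0$. -/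

import Mathlib

universe u v

/-- The `m`-fold composite `T ∘ T ∘ ⋯ ∘ T` of a binary relation with itself (the identity relation
for `m = 0`). Composition is read from left to right: `Relation.Comp S R x z` means that
`S x y` and `R y z` for some `y`. -/
def relPow {X : Type u} (T : X → X → Prop) : ℕ → X → X → Prop
  | 0 => Eq
  | m + 1 => Relation.Comp (relPow T m) T

/-- The symmetrization `T ∪ T⁻¹` of a binary relation. -/
def relSymm {X : Type u} (T : X → X → Prop) : X → X → Prop :=
  fun x y => T x y ∨ T y x

/-- `(S, R)` is a factorial pair on `X`. -/
structure IsFactorialPair {X : Type u} (S R : X → X → Prop) : Prop where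
  ord_S : IsStrictOrder X S
  ord_R : IsStrictOrder X R
  /-- The union of the symmetrizations is `X ^ 2` minus the diagonal. -/
  tot : ∀ x y, (relSymm R x y ∨ relSymm S x y) ↔ x ≠ y
  /-- The symmetrizations are disjoint. -/
  inters : ∀ x y, ¬ (relSymm R x y ∧ relSymm S x y)

/-- `(S, R)` belongs to the class `F_{h,k}(X)`: it is a factorial pair and `S^h ∘ R^k ⊆ R`. -/
structure IsFPair (h k : ℕ) {X : Type u} (S R : X → X → Prop) : Prop
    extends IsFactorialPair S R where
  comp : ∀ x y, Relation.Comp (relPow S h) (relPow R k) x y → R x y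

/-- Two pairs of relations, on `X` and on `Y`, are isomorphic. -/
def PairIso {X : Type u} {Y : Type v} (S R : X → X → Prop) (S' R' : Y → Y → Prop) : Prop :=
  ∃ e : X ≃ Y, (∀ x y, S x y ↔ S' (e x) (e y)) ∧ (∀ x y, R x y ↔ R' (e x) (e y))

/-- The set `F_{h,k}(X)` of pairs of relations `(S, R)` on `X`. -/
def FPair (h k : ℕ) (X : Type u) : Type u :=
  {p : (X → X → Prop) × (X → X → Prop) // IsFPair h k p.1 p.2}

/-- Isomorphism of pairs, as an equivalence relation on `F_{h,k}(X)`. -/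
def FPair.isoSetoid (h k : ℕ) (X : Type u) : Setoid (FPair h k X) where
  r p q := PairIso p.1.1 p.1.2 q.1.1 q.1.2
  iseqv :=
    { refl := fun _ => ⟨Equiv.refl X, fun _ _ => Iff.rfl, fun _ _ => Iff.rfl⟩
      symm := by
        rintro p q ⟨e, hS, hR⟩
        exact ⟨e.symm, fun x y => by simp [hS], fun x y => by simp [hR]⟩
      trans := by
        rintro p q r ⟨e, hS, hR⟩ ⟨f, hS', hR'⟩
        exact ⟨e.trans f, fun x y => by simp [hS, hS'], fun x y => by simp [hR, hR']⟩ }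

/-- Isomorphism classes of pairs in `F_{h,k}(X)`. -/
def FPairClass (h k : ℕ) (X : Type u) : Type u :=
  Quotient (FPair.isoSetoid h k X)

/-! In a factorial pair both `S ∪ R` and `S ∪ R⁻¹` are linear orders. Read as positions and values,
they turn `S` into the ascending pairs and `R` into the descending pairs of a permutation, and that
permutation is exactly the isomorphism class (`pairIso_ascentRel_descentRel_iff`). The condition `S
∘ S ∘ R ⊆ R` then forbids the patterns 1243 and 1342 (`isFPair_ascentRel_descentRel_iff`), so
permutations avoiding both have to be counted.

Cut an avoiding word at its maximum `m`. It has the form `H ++ (D ++ m :: E)`, where `H` is an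
avoiding word whose letters exceed all of `D` and `E`, and `D` is a decreasing prefix of the
avoiding word `D ++ E` missing its maximum (`Avoids.exists_split`, `avoids_append_peak`). To iterate
this, one counts marked words `(D, E)` by size `n` and prefix length `j`. The position of the two
largest letters relative to the mark gives the recursion `markedCount_succ`.

Let `y` be `X` times the large Schröder series, so `y = X (1 + y) + y²`, and let `z = 1 + y + y² +
⋯`. Then `y = X (1 + y) z`, whence `y ^ (j + 1) = X y ^ j + 2 X y ^ (j + 1) z`. On coefficients this
is the same recursion, so for `n ≠ 0` the count is the coefficient of `X ^ n` in `y ^ (j + 1)`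
(`markedCount_eq_coeff`); the theorem is the case `j = 0`. -/

/-! ### Words avoiding 1243 and 1342, and their shape around the maximum. -/

open List in
/-- No sublist of `l` is order isomorphic to `1243` or `1342`. -/
def Avoids (l : List ℕ) : Prop :=
  ∀ a b c d, [a, b, c, d] <+ l → a < b → b < c → d < c → d ≤ a

theorem Avoids.sublist {l l' : List ℕ} (h : Avoids l) (hl : l'.Sublist l) : Avoids l' :=
  fun a b c d hs => h a b c d (hs.trans hl)

theorem Avoids.map {l : List ℕ} (h : Avoids l) {s : Finset ℕ} {f : ℕ → ℕ}
    (hf : StrictMonoOn f s) (hl : ∀ x ∈ l, x ∈ s) : Avoids (l.map f) := by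
  intro a b c d hs hab hbc hdc
  obtain ⟨l', hl', he⟩ := List.sublist_map_iff.1 hs
  obtain ⟨a, b, c, d, rfl⟩ : ∃ a b c d, l' = [a, b, c, d] := by
    have : l'.length = 4 := by simpa using (congrArg List.length he).symm
    exact List.length_eq_four.1 this
  simp only [List.map_cons, List.map_nil, List.cons.injEq, and_true] at he
  obtain ⟨rfl, rfl, rfl, rfl⟩ := he
  have hm : ∀ x ∈ [a, b, c, d], x ∈ s := fun x hx => hl x (hl'.subset hx)
  simp only [List.mem_cons, List.not_mem_nil, or_false, forall_eq_or_imp, forall_eq] at hm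
  obtain ⟨ha, hb, hc, hd⟩ := hm
  rw [hf.lt_iff_lt ha hb] at hab
  rw [hf.lt_iff_lt hb hc] at hbc
  rw [hf.lt_iff_lt hd hc] at hdc
  exact (hf.le_iff_le hd ha).2 (h a b c d hl' hab hbc hdc)

/-- A quadruple that is a sublist of `l ++ l'` lies in `l`, or in `l'`, or starts in `l` and
ends in `l'`. -/
theorem quadruple_sublist_append {a b c d : ℕ} {l l' : List ℕ}
    (h : [a, b, c, d].Sublist (l ++ l')) :
    [a, b, c, d].Sublist l ∨ [a, b, c, d].Sublist l' ∨ (a ∈ l ∧ d ∈ l') := by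
  obtain ⟨u, v, he, hu, hv⟩ := List.sublist_append_iff.1 h
  rcases u with _ | ⟨x, u⟩
  · simp only [List.nil_append] at he
    exact Or.inr (Or.inl (he ▸ hv))
  · obtain rfl | ⟨v', y, rfl⟩ := List.eq_nil_or_concat v
    · simp only [List.append_nil] at he
      exact Or.inl (he ▸ hu)
    · refine Or.inr (Or.inr ⟨?_, ?_⟩)
      · simp only [List.cons_append, List.cons.injEq] at he
        exact he.1 ▸ hu.subset (by simp)
      · have he' : [a, b, c] ++ [d] = (x :: u ++ v') ++ [y] := by simpa using he
        obtain rfl : d = y := by simpa using (List.append_inj' he' rfl).2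
        exact hv.subset (by simp)

/-- A pattern cannot start in `H` and end later: its last letter would have to be `m`, but that
letter is below the third one. It uses at most one letter of `D`, because its first two letters
ascend. -/
theorem avoids_append_peak {H D E : List ℕ} {m : ℕ} (hH : ∀ x ∈ H, x < m) (hD : ∀ x ∈ D, x < m)
    (hE : ∀ x ∈ E, x < m) (hHD : ∀ x ∈ H, ∀ y ∈ D, y < x) (hHE : ∀ x ∈ H, ∀ y ∈ E, y < x)
    (hdec : D.Pairwise (· > ·)) :
    Avoids (H ++ (D ++ m :: E)) ↔ Avoids H ∧ Avoids (D ++ E) := by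
  constructor
  · refine fun h => ⟨h.sublist (List.sublist_append_left _ _), h.sublist ?_⟩
    exact ((List.Sublist.refl D).append (List.sublist_cons_self m E)).trans
      (List.sublist_append_right _ _)
  · rintro ⟨hAH, hADE⟩ a b c d hs hab hbc hdc
    have hc : c ≤ m := by
      have : c ∈ H ++ (D ++ m :: E) := hs.subset (by simp)
      simp only [List.mem_append, List.mem_cons] at this
      rcases this with h | h | h | h
      · exact (hH _ h).le
      · exact (hD _ h).le
      · exact h.le
      · exact (hE _ h).le
    rcases quadruple_sublist_append hs with h | h | ⟨h, h'⟩
    · exact hAH a b c d h hab hbc hdc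
    · obtain ⟨u, v, he, hu, hv⟩ := List.sublist_append_iff.1 h
      -- Past `D`, the letter `m` could only come first, hence be `a` or `b`; both are below `c ≤
      -- m`.
      have hE' : ∀ {l : List ℕ}, (∀ x ∈ l.head?, x < m) → l.Sublist (m :: E) → l.Sublist E := by
        intro l hl hs
        rcases List.sublist_cons_iff.1 hs with h | ⟨r, rfl, -⟩
        · exact h
        · simp at hl
      rcases u with _ | ⟨x, _ | ⟨y, u⟩⟩
      · simp only [List.nil_append] at he
        subst he
        refine hADE a b c d ((hE' ?_ hv).trans (List.sublist_append_right _ _)) hab hbc hdc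
        simp; omega
      · simp only [List.cons_append, List.nil_append, List.cons.injEq] at he
        obtain ⟨rfl, rfl⟩ := he
        refine hADE a b c d (hu.append (hE' ?_ hv)) hab hbc hdc
        simp; omega
      · simp only [List.cons_append, List.cons.injEq] at he
        obtain ⟨rfl, rfl, -⟩ := he
        have := hdec.sublist hu
        simp at this
        omega
    · simp only [List.mem_append, List.mem_cons] at h'
      rcases h' with h' | h' | h'
      · exact (hHD _ h _ h').le
      · omega
      · exact (hHE _ h _ h').le

/-- Every avoiding list with maximum `m` splits as in `avoids_append_peak`. -/
theorem Avoids.exists_split {X E : List ℕ} {m : ℕ} (h : Avoids (X ++ m :: E))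
    (hnd : (X ++ E).Nodup) (hX : ∀ x ∈ X, x < m) (hE : ∀ x ∈ E, x < m) :
    ∃ H D, X = H ++ D ∧ D.Pairwise (· > ·) ∧ (∀ x ∈ H, ∀ y ∈ D, y < x) ∧
      (∀ x ∈ H, ∀ y ∈ E, y < x) ∧ ∀ x ∈ D, ∃ y ∈ E, x < y := by
  classical
  -- An ascent `u < v` before `m` and a letter `e > u` after it would form a forbidden pattern.
  have key : ∀ u v e, [u, v].Sublist X → u < v → e ∈ E → e ≤ u := by
    intro u v e huv hlt he
    have h1 : [u, v, m, e].Sublist (X ++ m :: E) :=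
      huv.append ((List.singleton_sublist.2 he).cons_cons m)
    exact h u v m e h1 hlt (hX v (huv.subset (by simp))) (hE e he)
  -- `H` is the longest prefix of `X` dominating `E`. The letter `d` that ends it lies below some
  -- `e` in `E`, and `key` with this `e` makes everything from `d` on decreasing.
  set p : ℕ → Bool := fun x => decide (∀ e ∈ E, e < x) with hp
  have hXs : X = X.takeWhile p ++ X.dropWhile p := (List.takeWhile_append_dropWhile).symm
  have hH : ∀ x ∈ X.takeWhile p, ∀ y ∈ E, y < x := fun x hx => by
    simpa [hp] using List.mem_takeWhile_imp hx
  rcases hD : X.dropWhile p with _ | ⟨d, D⟩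
  · refine ⟨X, [], by simp, by simp, by simp, ?_, by simp⟩
    rw [hD, List.append_nil] at hXs
    rwa [← hXs] at hH
  · rw [hD] at hXs
    have hd : ¬ p d := by
      have := List.head_dropWhile_not p (l := X) (by simp [hD])
      simpa [hD] using this
    obtain ⟨e, heE, hde⟩ : ∃ e ∈ E, d ≤ e := by simpa [hp] using hd
    have hsub : (d :: D).Sublist X := hXs ▸ List.sublist_append_right _ _
    have hdisj := List.disjoint_of_nodup_append hnd
    have hne : ∀ x ∈ X, x ≠ e := fun x hx hxe => hdisj hx (hxe ▸ heE)
    have hndX : (d :: D).Nodup := (hnd.sublist (List.sublist_append_left _ _)).sublist hsub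
    have hde' : d < e := lt_of_le_of_ne hde (hne d (hsub.subset (by simp)))
    have hDd : ∀ x ∈ D, x < d := by
      intro x hx
      by_contra hcon
      have hxd : d < x := by
        have : d ≠ x := fun hdx => (List.nodup_cons.1 hndX).1 (hdx ▸ hx)
        omega
      have := key d x e (((List.singleton_sublist.2 hx).cons_cons d).trans hsub) hxd heE
      omega
    refine ⟨X.takeWhile p, d :: D, hXs, ?_, ?_, hH, ?_⟩
    · refine List.pairwise_cons.2 ⟨hDd, ?_⟩
      rw [List.pairwise_iff_forall_sublist]
      intro x y hxy
      by_contra hcon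
      have hxD : x ∈ D := hxy.subset (by simp)
      have hxy' : x < y := by
        have := (List.nodup_cons.1 hndX).2.sublist hxy
        simp at this
        omega
      have := key x y e ((hxy.trans (List.sublist_cons_self d D)).trans hsub) hxy' heE
      have := hDd x hxD
      omega
    · intro x hx y hy
      have := hH x hx e heE
      rcases List.mem_cons.1 hy with rfl | hy
      · omega
      · have := hDd y hy
        omega
    · intro x hx
      refine ⟨e, heE, ?_⟩
      rcases List.mem_cons.1 hx with rfl | hx
      · exact hde'
      · exact (hDd x hx).trans hde'

/-! ### Marked arrangements of a finite set. -/

/-- An avoiding arrangement `D ++ E` of the elements of `s`, with a decreasing prefix `D` that does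
not contain the maximum of `s`. -/
structure Marked (s : Finset ℕ) (D E : List ℕ) : Prop where
  nodup : (D ++ E).Nodup
  mem_iff : ∀ x, x ∈ s ↔ x ∈ D ∨ x ∈ E
  desc : D.Pairwise (· > ·)
  top : ∀ d ∈ D, ∃ e ∈ E, d < e
  avoids : Avoids (D ++ E)

namespace Marked

variable {s : Finset ℕ} {D E : List ℕ}

theorem toFinset_eq (h : Marked s D E) : (D ++ E).toFinset = s := by
  ext x
  simp [h.mem_iff]

theorem length_add (h : Marked s D E) : D.length + E.length = s.card := by
  rw [← h.toFinset_eq, List.toFinset_card_of_nodup h.nodup, List.length_append]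

theorem map (h : Marked s D E) {f : ℕ → ℕ} (hf : StrictMonoOn f s) :
    Marked (s.image f) (D.map f) (E.map f) := by
  have hD : ∀ x ∈ D, x ∈ s := fun x hx => (h.mem_iff x).2 (Or.inl hx)
  have hE : ∀ x ∈ E, x ∈ s := fun x hx => (h.mem_iff x).2 (Or.inr hx)
  have hDE : ∀ x ∈ D ++ E, x ∈ s := fun x hx => (h.mem_iff x).2 (List.mem_append.1 hx)
  refine ⟨?_, ?_, ?_, ?_, ?_⟩
  · rw [← List.map_append]
    exact h.nodup.map_on fun x hx y hy hxy => hf.injOn (hDE x hx) (hDE y hy) hxy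
  · intro x
    simp only [Finset.mem_image, h.mem_iff, List.mem_map]
    constructor
    · rintro ⟨a, ha | ha, rfl⟩
      · exact Or.inl ⟨a, ha, rfl⟩
      · exact Or.inr ⟨a, ha, rfl⟩
    · rintro (⟨a, ha, rfl⟩ | ⟨a, ha, rfl⟩)
      · exact ⟨a, Or.inl ha, rfl⟩
      · exact ⟨a, Or.inr ha, rfl⟩
  · rw [List.pairwise_map]
    exact h.desc.imp_of_mem fun {a b} ha hb hab => hf (hD b hb) (hD a ha) hab
  · simp only [List.mem_map, forall_exists_index, and_imp, forall_apply_eq_imp_iff₂,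
      exists_exists_and_eq_and]
    intro d hd
    obtain ⟨e, he, hde⟩ := h.top d hd
    exact ⟨e, he, hf (hD d hd) (hE e he) hde⟩
  · rw [← List.map_append]
    exact h.avoids.map hf hDE

end Marked

open Classical in
/-- The marked arrangements of `s` whose prefix has length `j`. -/
noncomputable def marked (s : Finset ℕ) (j : ℕ) : Finset (List ℕ × List ℕ) :=
  -- All cuts of all orderings of `s`: a finite set large enough for the filter to lose nothing.
  ((s.toList.permutations.toFinset ×ˢ Finset.range (s.card + 1)).image
    fun p => (p.1.take p.2, p.1.drop p.2)).filter fun p => Marked s p.1 p.2 ∧ p.1.length = j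

@[simp]
theorem mem_marked {s : Finset ℕ} {j : ℕ} {p : List ℕ × List ℕ} :
    p ∈ marked s j ↔ Marked s p.1 p.2 ∧ p.1.length = j := by
  classical
  obtain ⟨D, E⟩ := p
  rw [marked, Finset.mem_filter, and_iff_right_iff_imp]
  rintro ⟨h, -⟩
  refine Finset.mem_image.2 ⟨(D ++ E, D.length), ?_, by simp⟩
  simp only [Finset.mem_product, List.mem_toFinset, List.mem_permutations, Finset.mem_range]
  refine ⟨?_, by have := h.length_add; dsimp at this; omega⟩
  refine (List.perm_ext_iff_of_nodup h.nodup s.nodup_toList).2 fun x => ?_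
  simp [h.mem_iff]

theorem card_marked_le_of_strictMonoOn {s : Finset ℕ} {f : ℕ → ℕ} (hf : StrictMonoOn f s) (j : ℕ) :
    (marked s j).card ≤ (marked (s.image f) j).card := by
  refine Finset.card_le_card_of_injOn (fun p => (p.1.map f, p.2.map f)) ?_ ?_
  · rintro p hp
    rw [Finset.mem_coe, mem_marked] at hp ⊢
    exact ⟨hp.1.map hf, by simpa using hp.2⟩
  · rintro ⟨D, E⟩ hp ⟨D', E'⟩ hp' he
    rw [Finset.mem_coe, mem_marked] at hp hp'
    have key : ∀ {l l' : List ℕ}, (∀ x ∈ l, x ∈ s) → (∀ x ∈ l', x ∈ s) → l.map f = l'.map f →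
        l = l' := by
      intro l
      induction l with
      | nil => intro l' _ _ he; simpa using he.symm
      | cons a l ih =>
        rintro (_ | ⟨b, l'⟩) hl hl' he
        · simp at he
        · simp only [List.map_cons, List.cons.injEq, List.forall_mem_cons] at he hl hl'
          rw [hf.injOn hl.1 hl'.1 he.1, ih hl.2 hl'.2 he.2]
    simp only [Prod.mk.injEq] at he ⊢
    exact ⟨key (fun x hx => (hp.1.mem_iff x).2 (Or.inl hx))
      (fun x hx => (hp'.1.mem_iff x).2 (Or.inl hx)) he.1,
      key (fun x hx => (hp.1.mem_iff x).2 (Or.inr hx))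
      (fun x hx => (hp'.1.mem_iff x).2 (Or.inr hx)) he.2⟩

theorem exists_strictMonoOn_image_eq {s t : Finset ℕ} (h : s.card = t.card) :
    ∃ f : ℕ → ℕ, StrictMonoOn f s ∧ s.image f = t := by
  classical
  let e := (s.orderIsoOfFin rfl).symm.trans (t.orderIsoOfFin h.symm)
  refine ⟨fun x => if hx : x ∈ s then e ⟨x, hx⟩ else 0, ?_, ?_⟩
  · intro x hx y hy hxy
    rw [Finset.mem_coe] at hx hy
    simp only [hx, hy, dite_true]
    exact e.strictMono hxy
  · ext y
    simp only [Finset.mem_image]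
    constructor
    · rintro ⟨x, hx, rfl⟩
      simp [hx]
    · intro hy
      refine ⟨e.symm ⟨y, hy⟩, (e.symm ⟨y, hy⟩).2, ?_⟩
      simp

/-- Only the relative order of the letters matters. This transfers counts from intervals and from a
range with a gap back to initial segments. -/
theorem card_marked_congr {s t : Finset ℕ} (h : s.card = t.card) (j : ℕ) :
    (marked s j).card = (marked t j).card := by
  obtain ⟨f, hf, rfl⟩ := exists_strictMonoOn_image_eq h
  obtain ⟨g, hg, hg'⟩ := exists_strictMonoOn_image_eq h.symm
  refine (card_marked_le_of_strictMonoOn hf j).antisymm ?_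
  simpa only [hg'] using card_marked_le_of_strictMonoOn hg j

/-! ### Inserting and removing the maximum. -/

open Finset (range Ico Icc)

theorem Finset.eq_range_and_eq_Ico_of_union {s t : Finset ℕ} {n : ℕ} (h : s ∪ t = range n)
    (hst : ∀ a ∈ s, ∀ b ∈ t, b < a) : ∃ k ≤ n, s = Ico k n ∧ t = range k := by
  have hex : ∃ k, k ∉ t := Infinite.exists_notMem_finset t
  classical
  -- `k` is the least number missing from `t`.
  obtain ⟨k, hk, hmin⟩ : ∃ k, k ∉ t ∧ ∀ x < k, x ∈ t :=
    ⟨Nat.find hex, Nat.find_spec hex, fun x hx => not_not.1 (Nat.find_min hex hx)⟩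
  have hmem : ∀ x, (x ∈ s ∨ x ∈ t) ↔ x < n := fun x => by
    rw [← Finset.mem_union, h, Finset.mem_range]
  have ht : ∀ x, x ∈ t ↔ x < k := by
    refine fun x => ⟨fun hx => ?_, hmin x⟩
    by_contra hcon
    have hxk : k < x := by
      have : x ≠ k := fun h => hk (h ▸ hx)
      omega
    have hxn := (hmem x).1 (Or.inr hx)
    rcases (hmem k).2 (by omega) with hks | hkt
    · have := hst k hks x hx
      omega
    · exact hk hkt
  have hkn : k ≤ n := by
    by_contra hcon
    have := (hmem n).1 (Or.inr (hmin n (by omega)))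
    omega
  refine ⟨k, hkn, ?_, ?_⟩
  · ext x
    rw [Finset.mem_Ico]
    constructor
    · intro hx
      refine ⟨?_, (hmem x).1 (Or.inl hx)⟩
      by_contra hcon
      have := hst x hx x (hmin x (by omega))
      omega
    · rintro ⟨hkx, hxn⟩
      rcases (hmem x).2 hxn with hx | hx
      · exact hx
      · have := (ht x).1 hx
        omega
  · ext x
    rw [ht, Finset.mem_range]

namespace Marked

variable {s : Finset ℕ} {D E C H D₀ B : List ℕ} {n k : ℕ}

theorem mark (h : Marked s [] (D ++ E)) (hD : D.Pairwise (· > ·)) (ht : ∀ d ∈ D, ∃ e ∈ E, d < e) :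
    Marked s D E :=
  ⟨by simpa using h.nodup, fun x => by simpa using h.mem_iff x, hD, ht, by simpa using h.avoids⟩

theorem unmark (h : Marked s D E) : Marked s [] (D ++ E) :=
  ⟨by simpa using h.nodup, fun x => by simpa using h.mem_iff x, by simp, by simp,
    by simpa using h.avoids⟩

theorem insert_max (hkn : k ≤ n) (hH : Marked (Ico k n) [] H) (h : Marked (range k) D E) :
    Marked (range (n + 1)) [] (H ++ (D ++ n :: E)) := by
  have hHm : ∀ x, x ∈ H ↔ k ≤ x ∧ x < n := fun x => by
    have := hH.mem_iff x
    simp at this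
    exact this.symm
  have hm : ∀ x, (x ∈ D ∨ x ∈ E) ↔ x < k := fun x => by
    have := h.mem_iff x
    simp at this
    exact this.symm
  have hD : ∀ x ∈ D, x < k := fun x hx => (hm x).1 (Or.inl hx)
  have hE : ∀ x ∈ E, x < k := fun x hx => (hm x).1 (Or.inr hx)
  have hnd := hH.nodup
  rw [List.nil_append] at hnd
  refine ⟨?_, ?_, by simp, by simp, ?_⟩
  · rw [List.nil_append, List.nodup_append]
    refine ⟨hnd, ?_, ?_⟩
    · rw [List.nodup_middle, List.nodup_cons]
      refine ⟨fun hn => ?_, h.nodup⟩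
      have := (hm n).1 (List.mem_append.1 hn)
      omega
    · rintro a ha b hb rfl
      have ha := (hHm a).1 ha
      simp only [List.mem_append, List.mem_cons] at hb
      rcases hb with hb | hb | hb
      · have := hD _ hb; omega
      · omega
      · have := hE _ hb; omega
  · intro x
    have h1 := hHm x
    have h2 := hm x
    simp only [Finset.mem_range, List.not_mem_nil, false_or, List.mem_append, List.mem_cons]
    rw [or_left_comm (a := x ∈ D), h2, h1]
    omega
  · rw [List.nil_append, avoids_append_peak]
    · exact ⟨by simpa using hH.avoids, h.avoids⟩
    · exact fun x hx => ((hHm x).1 hx).2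
    · exact fun x hx => (hD x hx).trans_le hkn
    · exact fun x hx => (hE x hx).trans_le hkn
    · exact fun x hx y hy => (hD y hy).trans_le ((hHm x).1 hx).1
    · exact fun x hx y hy => (hE y hy).trans_le ((hHm x).1 hx).1
    · exact h.desc

theorem max_notMem (h : Marked (range (n + 1)) D₀ B) : n ∉ D₀ := by
  intro hn
  obtain ⟨e, he, hne⟩ := h.top n hn
  have := (h.mem_iff e).2 (Or.inr he)
  rw [Finset.mem_range] at this
  omega

theorem max_mem (h : Marked (range (n + 1)) D₀ B) : n ∈ B :=
  ((h.mem_iff n).1 (by simp)).resolve_left h.max_notMem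

/-- The mark `D₀` and the block `H` are both prefixes of the word before `n`; which one is longer is
left open here and decided in `card_marked_pred_max_notMem`. -/
theorem exists_insert_max (h : Marked (range (n + 1)) D₀ B) :
    ∃ k ≤ n, ∃ C H D E, B = C ++ n :: E ∧ D₀ ++ C = H ++ D ∧ Marked (Ico k n) [] H ∧
      Marked (range k) D E := by
  obtain ⟨C, E, rfl⟩ := List.append_of_mem h.max_mem
  have hnd := h.nodup
  have hav := h.avoids
  rw [← List.append_assoc] at hnd hav
  rw [List.nodup_middle, List.nodup_cons] at hnd
  have hmem : ∀ x, x ∈ (D₀ ++ C) ++ E ↔ x < n := by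
    intro x
    have := h.mem_iff x
    simp only [Finset.mem_range, List.mem_append, List.mem_cons] at this
    rw [List.append_assoc, List.mem_append, List.mem_append]
    constructor
    · intro hx
      have h1 : x < n + 1 := this.2 (by tauto)
      have h2 : x ≠ n := by
        rintro rfl
        exact hnd.1 (by simpa using hx)
      omega
    · intro hx
      have := this.1 (by omega)
      have h2 : x ≠ n := by omega
      tauto
  obtain ⟨H, D, he, hdec, hHD, hHE, htop⟩ := hav.exists_split hnd.2
    (fun x hx => (hmem x).1 (List.mem_append_left _ hx))
    (fun x hx => (hmem x).1 (List.mem_append_right _ hx))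
  rw [he] at hmem hav hnd
  obtain ⟨k, hk, hs, ht⟩ := Finset.eq_range_and_eq_Ico_of_union (s := H.toFinset)
    (t := (D ++ E).toFinset) (n := n) (by
      ext x
      rw [← List.toFinset_append, ← List.append_assoc, List.mem_toFinset, hmem, Finset.mem_range])
    (by
      intro a ha b hb
      rw [List.mem_toFinset] at ha hb
      rcases List.mem_append.1 hb with hb | hb
      · exact hHD a ha b hb
      · exact hHE a ha b hb)
  have hnd' := hnd.2
  rw [List.append_assoc] at hnd' hav
  refine ⟨k, hk, C, H, D, E, rfl, he, ⟨?_, ?_, by simp, by simp, ?_⟩, ⟨?_, ?_, hdec, htop, ?_⟩⟩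
  · simpa using hnd'.sublist (List.sublist_append_left _ _)
  · intro x
    simp [← hs]
  · simpa using hav.sublist (List.sublist_append_left _ _)
  · exact hnd'.sublist (List.sublist_append_right _ _)
  · intro x
    simp [← ht]
  · exact hav.sublist (((List.Sublist.refl D).append (List.sublist_cons_self n E)).trans
      (List.sublist_append_right _ _))

theorem insert_max_inj {k' : ℕ} {H' D' E' : List ℕ} (hkn : k ≤ n) (hkn' : k' ≤ n)
    (hH : Marked (Ico k n) [] H) (h : Marked (range k) D E)
    (hH' : Marked (Ico k' n) [] H') (h' : Marked (range k') D' E')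
    (he : H ++ (D ++ n :: E) = H' ++ (D' ++ n :: E')) : k = k' ∧ H = H' ∧ D = D' ∧ E = E' := by
  have hn : n ∉ H ++ D ∧ n ∉ E := by
    have h1 := hH.mem_iff n
    have h2 := h.mem_iff n
    have h3 : ¬ n < k := by omega
    simp [h3] at h1 h2
    simp [h1, h2]
  rw [← List.append_assoc, ← List.append_assoc,
    List.append_cons_inj_of_notMem hn.1 hn.2] at he
  obtain ⟨he, -, rfl⟩ := he
  -- `E` determines `k`: by `top`, the largest element of a nonempty `range k` lies in `E`.
  have not_lt : ∀ {k k' D D'}, Marked (range k) D E → Marked (range k') D' E →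
      ¬ k < k' := by
    intro k k' D D' h h' hlt
    have hE : k' - 1 ∉ E := by
      intro hx
      have := (h.mem_iff _).2 (Or.inr hx)
      rw [Finset.mem_range] at this
      omega
    have hD' : k' - 1 ∈ D' :=
      ((h'.mem_iff (k' - 1)).1 (by rw [Finset.mem_range]; omega)).resolve_right hE
    obtain ⟨e, he, hlt'⟩ := h'.top _ hD'
    have := (h'.mem_iff _).2 (Or.inr he)
    rw [Finset.mem_range] at this
    omega
  obtain rfl : k = k' := le_antisymm
    (Nat.le_of_not_lt (not_lt h' h)) (Nat.le_of_not_lt (not_lt h h'))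
  have hlen : H.length = H'.length := by
    have a := hH.length_add
    have b := hH'.length_add
    simp at a b
    omega
  obtain ⟨rfl, rfl⟩ := List.append_inj he hlen
  exact ⟨rfl, rfl, rfl, rfl⟩

end Marked

/-! ### The recursion for the number of marked arrangements. -/

/-- All marked arrangements of `s`. -/
noncomputable def allMarked (s : Finset ℕ) : Finset (List ℕ × List ℕ) :=
  open Classical in (range (s.card + 1)).biUnion (marked s)

@[simp]
theorem mem_allMarked {s : Finset ℕ} {p : List ℕ × List ℕ} :
    p ∈ allMarked s ↔ Marked s p.1 p.2 := by
  classical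
  rw [allMarked]
  simp only [Finset.mem_biUnion, mem_marked, Finset.mem_range]
  constructor
  · rintro ⟨_, _, h, _⟩
    exact h
  · intro h
    exact ⟨_, by have := h.length_add; omega, h, rfl⟩

theorem card_filter_allMarked {s : Finset ℕ} (j : ℕ) :
    ((allMarked s).filter fun p => j ≤ p.1.length).card =
      ∑ i ∈ Icc j s.card, (marked s i).card := by
  classical
  rw [← Finset.card_biUnion]
  · congr 1
    ext p
    simp only [Finset.mem_filter, mem_allMarked, Finset.mem_biUnion, Finset.mem_Icc, mem_marked]
    constructor
    · rintro ⟨h, hj⟩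
      exact ⟨_, ⟨hj, by have := h.length_add; omega⟩, h, rfl⟩
    · rintro ⟨i, ⟨h1, -⟩, h, rfl⟩
      exact ⟨h, h1⟩
  · intro i _ i' _ hne
    rw [Function.onFun, Finset.disjoint_left]
    intro p hp hp'
    rw [mem_marked] at hp hp'
    exact hne (hp.2.symm.trans hp'.2)

theorem card_allMarked {s : Finset ℕ} :
    (allMarked s).card = ∑ i ∈ range (s.card + 1), (marked s i).card := by
  have := card_filter_allMarked (s := s) 0
  simp only [zero_le, Finset.filter_true] at this
  rw [this, Finset.range_eq_Ico, Finset.Ico_add_one_right_eq_Icc]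

/-- Here `n` is the second largest letter. The mark never contains `n + 1` and is decreasing, so `n`
is its first letter and can be deleted. -/
theorem card_marked_pred_max_mem (n j : ℕ) :
    ((marked (range (n + 2)) (j + 1)).filter fun p => n ∈ p.1).card =
      (marked (range (n + 1)) j).card := by
  rw [card_marked_congr (s := range (n + 1)) (t := (range (n + 2)).erase n) (by simp)]
  symm
  refine Finset.card_nbij (fun p => (n :: p.1, p.2)) ?_ ?_ ?_
  · rintro ⟨D, E⟩ hp
    rw [Finset.mem_coe, mem_marked] at hp
    obtain ⟨h, hj⟩ := hp
    dsimp only at h hj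
    have hm : ∀ x, (x ∈ D ∨ x ∈ E) ↔ x ≠ n ∧ x < n + 2 := fun x => by
      rw [← h.mem_iff, Finset.mem_erase, Finset.mem_range]
    have hD : n + 1 ∉ D := by
      intro hn
      obtain ⟨e, he, hlt⟩ := h.top _ hn
      have := (hm e).1 (Or.inr he)
      omega
    have hE : n + 1 ∈ E := ((hm (n + 1)).2 (by omega)).resolve_left hD
    have hDn : ∀ x ∈ D, x < n := by
      intro x hx
      have h1 := (hm x).1 (Or.inl hx)
      have h2 : x ≠ n + 1 := fun h => hD (h ▸ hx)
      omega
    simp only [Finset.mem_coe, Finset.mem_filter, mem_marked, List.mem_cons, true_or, and_true, List.length_cons,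
      hj]
    refine ⟨?_, ?_, ?_, ?_, ?_⟩
    · rw [List.cons_append, List.nodup_cons]
      refine ⟨fun hn => ?_, h.nodup⟩
      exact ((hm n).1 (List.mem_append.1 hn)).1 rfl
    · intro x
      rw [List.mem_cons, or_assoc, hm, Finset.mem_range]
      omega
    · exact List.pairwise_cons.2 ⟨hDn, h.desc⟩
    · rintro d hd
      rcases List.mem_cons.1 hd with rfl | hd
      · exact ⟨_, hE, by omega⟩
      · exact h.top d hd
    · intro a b c d hs hab hbc hdc
      -- A leading `n` could only be the letter `a` of a pattern, which needs two larger letters;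
      -- only `n + 1` is available.
      rw [List.cons_append, List.sublist_cons_iff] at hs
      rcases hs with hs | ⟨r, hr, hs⟩
      · exact h.avoids a b c d hs hab hbc hdc
      · simp only [List.cons.injEq] at hr
        obtain ⟨rfl, rfl⟩ := hr
        have := (hm c).1 (List.mem_append.1 (hs.subset (by simp)))
        omega
  · rintro ⟨D, E⟩ - ⟨D', E'⟩ - he
    simpa using he
  · rintro ⟨D₀, E⟩ hp
    simp only [Finset.coe_filter, mem_marked, Set.mem_ofPred_eq] at hp
    obtain ⟨⟨h, hj⟩, hn⟩ := hp
    obtain _ | ⟨x, D⟩ := D₀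
    · simp at hn
    have hx : x = n := by
      have h1 : x ≠ n + 1 := by
        rintro rfl
        exact h.max_notMem (by simp)
      have h2 := (h.mem_iff x).2 (by simp)
      rw [Finset.mem_range] at h2
      rcases List.mem_cons.1 hn with hn | hn
      · exact hn.symm
      · have := (List.pairwise_cons.1 h.desc).1 n hn
        omega
    subst hx
    have hnd := h.nodup
    rw [List.cons_append, List.nodup_cons] at hnd
    refine ⟨(D, E), ?_, rfl⟩
    rw [Finset.mem_coe, mem_marked]
    refine ⟨⟨hnd.2, ?_, (List.pairwise_cons.1 h.desc).2, ?_, ?_⟩, by simpa using hj⟩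
    · intro y
      have := h.mem_iff y
      rw [List.mem_cons, or_assoc] at this
      rw [Finset.mem_erase, this]
      constructor
      · tauto
      · intro hy
        refine ⟨?_, Or.inr hy⟩
        rintro rfl
        exact hnd.1 (List.mem_append.2 hy)
    · exact fun d hd => h.top d (List.mem_cons_of_mem _ hd)
    · exact h.avoids.sublist (List.sublist_cons_self _ _)

/-- The first sum is the case of empty `H`: the mark is the first `j` letters of a decreasing block
of length at least `j`. In the second sum `H` is nonempty and contains `n - 1`, so a mark without `n
- 1` ends inside `H` and is a legal mark of `H`. -/
theorem card_marked_pred_max_notMem (n j : ℕ) :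
    ((marked (range (n + 1)) j).filter fun p => ∀ x ∈ p.1, x + 1 ≠ n).card =
      ∑ i ∈ Icc j n, (marked (range n) i).card +
        ∑ k ∈ range n, (marked (Ico k n) j).card *
          ∑ i ∈ range (k + 1), (marked (range k) i).card := by
  have h1 := card_filter_allMarked (s := range n) j
  have h2 : ∀ k, (allMarked (range k)).card = _ := fun k => card_allMarked (s := range k)
  simp only [Finset.card_range] at h1 h2
  rw [← h1]
  simp only [← h2, ← Finset.card_product]
  rw [← Finset.card_sigma, ← Finset.card_disjSum]
  symm
  have hemp : Marked (Ico n n) [] [] :=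
    ⟨by simp, by simp, by simp, by simp, fun a b c d hs => by simp at hs⟩
  refine Finset.card_nbij (Sum.elim (fun p => (p.1.take j, p.1.drop j ++ n :: p.2))
    (fun q => (q.2.1.1, q.2.1.2 ++ (q.2.2.1 ++ n :: q.2.2.2)))) ?_ ?_ ?_
  · rintro (⟨D, E⟩ | ⟨k, ⟨D₀, C⟩, ⟨D, E⟩⟩) hp
    · simp only [Finset.mem_coe, Finset.inl_mem_disjSum, Finset.mem_filter, mem_allMarked] at hp
      obtain ⟨h, hj⟩ := hp
      have h' := Marked.insert_max le_rfl hemp h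
      rw [List.nil_append, ← List.take_append_drop j D, List.append_assoc] at h'
      have hlt : ∀ d ∈ D, d < n := fun d hd => by
        simpa using (h.mem_iff d).2 (Or.inl hd)
      simp only [Sum.elim_inl, Finset.mem_coe, Finset.mem_filter, mem_marked, List.length_take, hj, inf_of_le_left,
        and_true]
      refine ⟨h'.mark (h.desc.sublist (List.take_sublist _ _)) fun d hd => ?_, fun x hx hxn => ?_⟩
      · exact ⟨n, by simp, hlt d (List.mem_of_mem_take hd)⟩
      · obtain ⟨e, he, hxe⟩ := h.top x (List.mem_of_mem_take hx)
        have : e < n := by simpa using (h.mem_iff e).2 (Or.inr he)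
        omega
    · simp only [Finset.mem_coe, Finset.inr_mem_disjSum, Finset.mem_sigma, Finset.mem_product, Finset.mem_range,
        mem_marked, mem_allMarked] at hp
      obtain ⟨hk, ⟨hH, hj⟩, h⟩ := hp
      have h' := Marked.insert_max hk.le hH.unmark h
      rw [List.append_assoc] at h'
      have hlt : ∀ x, x ∈ D₀ ∨ x ∈ C → x < n := fun x hx =>
        (Finset.mem_Ico.1 ((hH.mem_iff x).2 hx)).2
      simp only [Sum.elim_inr, Finset.mem_coe, Finset.mem_filter, mem_marked, hj, and_true]
      refine ⟨h'.mark hH.desc fun d hd => ?_, fun x hx hxn => ?_⟩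
      · exact ⟨n, by simp, hlt d (Or.inl hd)⟩
      · obtain ⟨e, he, hxe⟩ := hH.top x hx
        have := hlt e (Or.inr he)
        omega
  · rintro (⟨D, E⟩ | ⟨k, ⟨D₀, C⟩, ⟨D, E⟩⟩) hp (⟨D', E'⟩ | ⟨k', ⟨D₀', C'⟩, ⟨D', E'⟩⟩) hp' he <;>
    simp only [Finset.mem_coe, Finset.inl_mem_disjSum, Finset.mem_filter, mem_allMarked,
      Finset.inr_mem_disjSum, Finset.mem_sigma, Finset.mem_product, Finset.mem_range,
      mem_marked] at hp hp' <;>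
    simp only [Sum.elim_inl, Sum.elim_inr, Prod.mk.injEq] at he
    · have he' : [] ++ (D ++ n :: E) = [] ++ (D' ++ n :: E') := by
        rw [← List.take_append_drop j D, ← List.take_append_drop j D', List.append_assoc,
          List.append_assoc, he.1, he.2]
      obtain ⟨-, -, rfl, rfl⟩ := Marked.insert_max_inj le_rfl le_rfl hemp hp.1 hemp hp'.1 he'
      rfl
    · have he' : [] ++ (D ++ n :: E) = (D₀' ++ C') ++ (D' ++ n :: E') := by
        rw [← List.take_append_drop j D, List.append_assoc, List.append_assoc, he.1, he.2]
        rfl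
      have := (Marked.insert_max_inj le_rfl hp'.1.le hemp hp.1 hp'.2.1.1.unmark hp'.2.2 he').1
      omega
    · have he' : (D₀ ++ C) ++ (D ++ n :: E) = [] ++ (D' ++ n :: E') := by
        rw [← List.take_append_drop j D', List.append_assoc, List.append_assoc, he.1, he.2]
        rfl
      have := (Marked.insert_max_inj hp.1.le le_rfl hp.2.1.1.unmark hp.2.2 hemp hp'.1 he').1
      omega
    · have he' : (D₀ ++ C) ++ (D ++ n :: E) = (D₀' ++ C') ++ (D' ++ n :: E') := by
        rw [List.append_assoc, List.append_assoc, he.1, he.2]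
      obtain ⟨rfl, hDC, rfl, rfl⟩ := Marked.insert_max_inj hp.1.le hp'.1.le hp.2.1.1.unmark hp.2.2
        hp'.2.1.1.unmark hp'.2.2 he'
      obtain ⟨rfl, rfl⟩ := List.append_inj hDC (by rw [hp.2.1.2, hp'.2.1.2])
      rfl
  · rintro ⟨D₀, B⟩ hp
    simp only [Finset.coe_filter, mem_marked, Set.mem_ofPred_eq] at hp
    obtain ⟨⟨hM, hj⟩, hn⟩ := hp
    obtain ⟨k, hk, C, H, D, E, rfl, he, hH, h⟩ := hM.exists_insert_max
    have hlt : ∀ x, x ∈ H ↔ k ≤ x ∧ x < n := fun x => by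
      have := hH.mem_iff x
      simp at this
      exact this.symm
    rcases hk.eq_or_lt with rfl | hk
    · obtain rfl : H = [] := by
        rw [List.eq_nil_iff_forall_not_mem]
        intro x hx
        have := (hlt x).1 hx
        omega
      obtain rfl : D₀ ++ C = D := by simpa using he
      refine ⟨Sum.inl (D₀ ++ C, E), ?_, ?_⟩
      · simp [h, ← hj]
      · simp [← hj]
    · have hnH : n - 1 ∈ H := (hlt _).2 (by omega)
      have hnD : n - 1 ∉ D₀ := fun hx => hn _ hx (by omega)
      rcases List.append_eq_append_iff.1 he with ⟨C₁, rfl, rfl⟩ | ⟨C₁, rfl, rfl⟩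
      · refine ⟨Sum.inr ⟨k, (D₀, C₁), (D, E)⟩, ?_, by simp⟩
        simp only [Finset.mem_coe, Finset.inr_mem_disjSum, Finset.mem_sigma, Finset.mem_product,
          Finset.mem_range, mem_marked, mem_allMarked]
        refine ⟨hk, ⟨hH.mark hM.desc fun d hd => ?_, hj⟩, h⟩
        refine ⟨n - 1, (List.mem_append.1 hnH).resolve_left hnD, ?_⟩
        have h1 := (hlt d).1 (List.mem_append_left _ hd)
        have h2 := hn d hd
        omega
      -- A mark containing all of `H` would contain `n - 1`.
      · exact absurd (List.mem_append_left _ hnH) hnD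

/-- The number of marked arrangements of `n` elements with a marked prefix of length `j`. -/
noncomputable def markedCount (n j : ℕ) : ℕ := (marked (range n) j).card

theorem markedCount_zero (j : ℕ) : markedCount 0 j = if j = 0 then 1 else 0 := by
  have : ∀ D E, Marked (range 0) D E ↔ D = [] ∧ E = [] := by
    refine fun D E => ⟨fun h => ?_, ?_⟩
    · have := h.length_add
      simpa using this
    · rintro ⟨rfl, rfl⟩
      exact ⟨by simp, by simp, by simp, by simp, fun a b c d hs => by simp at hs⟩
  rw [markedCount]
  split_ifs with hj
  · rw [Finset.card_eq_one]
    refine ⟨([], []), ?_⟩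
    ext ⟨D, E⟩
    rw [mem_marked, this]
    simp [hj]
    tauto
  · rw [Finset.card_eq_zero, Finset.eq_empty_iff_forall_notMem]
    rintro ⟨D, E⟩ h
    rw [mem_marked, this] at h
    obtain ⟨⟨rfl, rfl⟩, rfl⟩ := h
    exact hj rfl

theorem markedCount_succ (n j : ℕ) :
    markedCount (n + 1) j = (if n ≠ 0 ∧ j ≠ 0 then markedCount n (j - 1) else 0) +
      (∑ i ∈ Icc j n, markedCount n i +
        ∑ k ∈ range n, markedCount (n - k) j * ∑ i ∈ range (k + 1), markedCount k i) := by
  classical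
  have h2 := card_marked_pred_max_notMem n j
  have h3 : ∀ k, (marked (Ico k n) j).card = markedCount (n - k) j := fun k =>
    card_marked_congr (by simp) j
  simp only [h3] at h2
  simp only [markedCount] at h2 ⊢
  rw [← h2]
  rw [← Finset.card_filter_add_card_filter_not (s := marked (range (n + 1)) j)
    (fun p => ∀ x ∈ p.1, x + 1 ≠ n), add_comm]
  congr 1
  split_ifs with h
  · obtain ⟨hn, hj⟩ := h
    obtain ⟨n, rfl⟩ := Nat.exists_eq_succ_of_ne_zero hn
    obtain ⟨j, rfl⟩ := Nat.exists_eq_succ_of_ne_zero hj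
    rw [Nat.succ_sub_one, ← card_marked_pred_max_mem]
    congr 1
    ext p
    simp
  -- A mark containing the predecessor of `n` needs `n ≠ 0` and a nonempty prefix.
  · rw [Finset.card_eq_zero, Finset.eq_empty_iff_forall_notMem]
    rintro ⟨D, E⟩ hp
    simp only [Finset.mem_filter, mem_marked, not_forall, not_not] at hp
    obtain ⟨⟨-, hj⟩, x, hx, hxn⟩ := hp
    refine h ⟨by omega, ?_⟩
    rintro rfl
    simp [List.length_eq_zero_iff.1 hj] at hx

/-! ### Generating functions: the powers of the shifted Schröder series. -/

namespace PowerSeries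

/-- The generating function of the avoiding arrangements of a nonempty set. -/
noncomputable def shiftedSchroderSeries : PowerSeries ℕ := X * largeSchroderSeries

theorem shiftedSchroderSeries_eq :
    shiftedSchroderSeries =
      X * (1 + shiftedSchroderSeries) + shiftedSchroderSeries * shiftedSchroderSeries := by
  have h :=
    largeSchroderSeries_eq_one_add_X_mul_largeSchroderSeries_add_X_mul_largeSchroderSeries_sq
  rw [shiftedSchroderSeries]
  conv_lhs => rw [h]
  ring

theorem coeff_shiftedSchroderSeries_pow_eq_zero {n i : ℕ} (h : n < i) :
    coeff n (shiftedSchroderSeries ^ i) = 0 := by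
  rw [shiftedSchroderSeries, mul_pow, coeff_X_pow_mul', if_neg (by omega)]

/-- The sum of the powers of `shiftedSchroderSeries`. -/
noncomputable def shiftedSchroderGeom : PowerSeries ℕ :=
  -- The `i`-th power has no term of degree below `i`, so stopping at `i = n` loses nothing.
  mk fun n => ∑ i ∈ range (n + 1), coeff n (shiftedSchroderSeries ^ i)

theorem coeff_shiftedSchroderGeom {n N : ℕ} (h : n < N) :
    coeff n shiftedSchroderGeom = coeff n (∑ i ∈ range N, shiftedSchroderSeries ^ i) := by
  rw [shiftedSchroderGeom, coeff_mk, map_sum]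
  refine Finset.sum_subset (Finset.range_subset_range.2 h) fun i _ hi => ?_
  exact coeff_shiftedSchroderSeries_pow_eq_zero (by simpa using hi)

theorem coeff_mul_shiftedSchroderGeom (f : PowerSeries ℕ) {n N : ℕ} (h : n < N) :
    coeff n (f * shiftedSchroderGeom) =
      coeff n (f * ∑ i ∈ range N, shiftedSchroderSeries ^ i) := by
  rw [coeff_mul, coeff_mul]
  refine Finset.sum_congr rfl fun p hp => ?_
  rw [Finset.HasAntidiagonal.mem_antidiagonal] at hp
  rw [coeff_shiftedSchroderGeom (N := N) (by omega)]

theorem shiftedSchroderGeom_eq :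
    shiftedSchroderGeom = 1 + shiftedSchroderSeries * shiftedSchroderGeom := by
  ext n
  rw [map_add, coeff_mul_shiftedSchroderGeom _ (Nat.lt_succ_self n),
    coeff_shiftedSchroderGeom (N := n + 1 + 1) (by omega), Finset.sum_range_succ',
    Finset.mul_sum, add_comm, map_add]
  simp [pow_succ']

theorem shiftedSchroderSeries_eq_mul_geom :
    shiftedSchroderSeries = X * (1 + shiftedSchroderSeries) * shiftedSchroderGeom := by
  have h1 := shiftedSchroderSeries_eq
  have h2 := shiftedSchroderGeom_eq
  generalize shiftedSchroderSeries = y at *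
  generalize shiftedSchroderGeom = z at *
  -- Coefficients are natural numbers, so instead of dividing by `1 - y` the term `y * y * z` is
  -- added to both sides and cancelled coefficientwise.
  have key : y + y * y * z = X * (1 + y) * z + y * y * z := by
    calc y + y * y * z = y * (1 + y * z) := by ring
      _ = y * z := by rw [← h2]
      _ = (X * (1 + y) + y * y) * z := by rw [← h1]
      _ = _ := by ring
  ext n
  simpa using congrArg (coeff n) key

theorem shiftedSchroderSeries_pow_succ (j : ℕ) :
    shiftedSchroderSeries ^ (j + 1) =
      X * shiftedSchroderSeries ^ j +
        X * (shiftedSchroderSeries ^ (j + 1) * shiftedSchroderGeom) +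
        X * (shiftedSchroderSeries ^ (j + 1) * shiftedSchroderGeom) := by
  have h1 := shiftedSchroderSeries_eq_mul_geom
  have h2 := shiftedSchroderGeom_eq
  generalize shiftedSchroderSeries = y at *
  generalize shiftedSchroderGeom = z at *
  calc y ^ (j + 1) = y ^ j * y := pow_succ _ _
    _ = y ^ j * (X * (1 + y) * z) := by rw [← h1]
    _ = X * y ^ j * z + X * (y ^ (j + 1) * z) := by ring
    _ = X * y ^ j * (1 + y * z) + X * (y ^ (j + 1) * z) := by rw [← h2]
    _ = _ := by ring

end PowerSeries

open PowerSeries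

/-- Size zero is excluded: the empty arrangement counts once for `j = 0`, while `y` has no constant
term. -/
theorem markedCount_eq_coeff (n : ℕ) (hn : n ≠ 0) (j : ℕ) :
    markedCount n j = coeff n (shiftedSchroderSeries ^ (j + 1)) := by
  induction n using Nat.strong_induction_on generalizing j with
  | _ n ih =>
    obtain ⟨n, rfl⟩ := Nat.exists_eq_succ_of_ne_zero hn
    have hgeom : ∀ k ≤ n, ∑ i ∈ range (k + 1), markedCount k i =
        coeff k shiftedSchroderGeom := by
      intro k hk
      rcases Nat.eq_zero_or_pos k with rfl | hk0
      · simp [markedCount_zero, shiftedSchroderGeom]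
      · rw [coeff_shiftedSchroderGeom (N := k + 1 + 1) (by omega),
          Finset.sum_range_succ' (fun i => shiftedSchroderSeries ^ i), map_add, map_sum, pow_zero, coeff_one, if_neg hk0.ne', add_zero]
        exact Finset.sum_congr rfl fun i _ => ih k (by omega) hk0.ne' i
    rw [Nat.succ_eq_add_one, shiftedSchroderSeries_pow_succ, map_add, map_add, coeff_succ_X_mul,
      coeff_succ_X_mul, markedCount_succ]
    have h3 : ∑ k ∈ range n, markedCount (n - k) j * ∑ i ∈ range (k + 1), markedCount k i =
        coeff n (shiftedSchroderSeries ^ (j + 1) * shiftedSchroderGeom) := by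
      -- The convolution has one extra term, at `k = n`, which vanishes because `y` has no constant
      -- term.
      rw [mul_comm, coeff_mul, Finset.Nat.sum_antidiagonal_eq_sum_range_succ_mk,
        Finset.sum_range_succ, Nat.sub_self,
        coeff_shiftedSchroderSeries_pow_eq_zero (Nat.succ_pos j), mul_zero, add_zero]
      refine Finset.sum_congr rfl fun k hk => ?_
      rw [Finset.mem_range] at hk
      rw [hgeom k hk.le, ih (n - k) (by omega) (by omega), mul_comm]
    have h12 : (if n ≠ 0 ∧ j ≠ 0 then markedCount n (j - 1) else 0) +
        ∑ i ∈ Icc j n, markedCount n i =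
          coeff n (shiftedSchroderSeries ^ j) +
            coeff n (shiftedSchroderSeries ^ (j + 1) * shiftedSchroderGeom) := by
      -- For `n = 0` the roles shift: the empty arrangement in the `Icc` sum supplies the constant
      -- term of `y ^ 0`. For `n > 0` the summands on the two sides agree one by one.
      rcases Nat.eq_zero_or_pos n with rfl | hn0
      · rcases Nat.eq_zero_or_pos j with rfl | hj
        · simp [markedCount_zero, shiftedSchroderSeries]
        · rw [coeff_shiftedSchroderSeries_pow_eq_zero hj, Finset.Icc_eq_empty (by omega)]
          simp [shiftedSchroderSeries]
      · congr 1
        · rcases Nat.eq_zero_or_pos j with rfl | hj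
          · simp [coeff_one, hn0.ne']
          · rw [if_pos ⟨hn0.ne', hj.ne'⟩, ih n (by omega) hn0.ne', Nat.sub_add_cancel hj]
        · rw [coeff_mul_shiftedSchroderGeom _ (Nat.lt_succ_self n), Finset.mul_sum, map_sum]
          have : ∀ i ∈ Icc j n, markedCount n i = coeff n (shiftedSchroderSeries ^ (i + 1)) :=
            fun i _ => ih n (by omega) hn0.ne' i
          rw [Finset.sum_congr rfl this, ← Finset.Ico_add_one_right_eq_Icc,
            Finset.sum_Ico_eq_sum_range]
          simp only [← pow_add]
          refine Finset.sum_subset_zero_on_sdiff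
            (Finset.range_subset_range.2 (by omega)) ?_ ?_
          · intro i hi
            simp only [Finset.mem_sdiff, Finset.mem_range] at hi
            exact coeff_shiftedSchroderSeries_pow_eq_zero (by omega)
          · intro i _
            congr 2
            omega
    rw [← add_assoc, h12, h3]

theorem card_marked_range_zero {n : ℕ} (hn : 1 ≤ n) :
    (marked (range n) 0).card = Nat.largeSchroder (n - 1) := by
  have := markedCount_eq_coeff n (by omega) 0
  rwa [zero_add, pow_one, shiftedSchroderSeries, coeff_X_mul_largeSchroderSeries n hn] at this

/-! ### Permutations as avoiding words. -/

/-- A permutation of `Fin n` avoiding the patterns `1243` and `1342`. -/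
def AvoidsPerm {n : ℕ} (σ : Equiv.Perm (Fin n)) : Prop :=
  ∀ i j k m, i < j → j < k → k < m → σ i < σ j → σ j < σ k → σ m < σ k → σ m < σ i

theorem quadruple_sublist_finRange_iff {n : ℕ} {i j k m : Fin n} :
    [i, j, k, m].Sublist (List.finRange n) ↔ i < j ∧ j < k ∧ k < m := by
  constructor
  · intro h
    have := (List.pairwise_lt_finRange n).sublist h
    simp only [List.pairwise_cons, List.mem_cons, forall_eq_or_imp] at this
    tauto
  · rintro ⟨hij, hjk, hkm⟩
    have hik := hij.trans hjk
    have hjm := hjk.trans hkm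
    have him := hij.trans hjm
    have hlt : [i, j, k, m].Pairwise (· < ·) := by simp [hij, hjk, hkm, hik, hjm, him]
    refine List.sublist_of_subperm_of_pairwise ?_ (hlt.imp le_of_lt)
      ((List.pairwise_lt_finRange n).imp le_of_lt)
    exact List.subperm_of_subset (hlt.imp ne_of_lt) fun x _ => List.mem_finRange x

theorem avoids_map_finRange_iff {n : ℕ} (σ : Equiv.Perm (Fin n)) :
    Avoids ((List.finRange n).map fun i => (σ i : ℕ)) ↔ AvoidsPerm σ := by
  constructor
  · intro h i j k m hij hjk hkm h1 h2 h3
    have hs := (quadruple_sublist_finRange_iff.2 ⟨hij, hjk, hkm⟩).map fun i => (σ i : ℕ)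
    have hle : σ m ≤ σ i := h _ _ _ _ hs h1 h2 h3
    exact lt_of_le_of_ne hle fun he => (hij.trans (hjk.trans hkm)).ne (σ.injective he).symm
  · intro h a b c d hs hab hbc hdc
    obtain ⟨l, hl, he⟩ := List.sublist_map_iff.1 hs
    obtain ⟨i, j, k, m, rfl⟩ : ∃ i j k m, l = [i, j, k, m] := by
      have : l.length = 4 := by simpa using (congrArg List.length he).symm
      exact List.length_eq_four.1 this
    simp only [List.map_cons, List.map_nil, List.cons.injEq, and_true] at he
    obtain ⟨rfl, rfl, rfl, rfl⟩ := he
    obtain ⟨hij, hjk, hkm⟩ := quadruple_sublist_finRange_iff.1 hl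
    exact (h i j k m hij hjk hkm hab hbc hdc).le

theorem card_avoidsPerm (n : ℕ) :
    Nat.card {σ : Equiv.Perm (Fin n) // AvoidsPerm σ} = (marked (range n) 0).card := by
  classical
  rw [Nat.card_eq_fintype_card, Fintype.card_subtype]
  refine Finset.card_nbij (fun σ => ([], (List.finRange n).map fun i => (σ i : ℕ))) ?_ ?_ ?_
  · intro σ hσ
    rw [Finset.mem_coe, Finset.mem_filter_univ] at hσ
    rw [Finset.mem_coe, mem_marked]
    refine ⟨⟨?_, ?_, by simp, by simp, ?_⟩, rfl⟩
    · rw [List.nil_append]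
      exact (List.nodup_finRange n).map (Fin.val_injective.comp σ.injective)
    · intro x
      simp only [Finset.mem_range, List.not_mem_nil, List.mem_map, List.mem_finRange, true_and,
        false_or]
      constructor
      · intro hx
        exact ⟨σ.symm ⟨x, hx⟩, by simp⟩
      · rintro ⟨i, rfl⟩
        exact (σ i).2
    · rw [List.nil_append]
      exact (avoids_map_finRange_iff σ).2 hσ
  · intro σ _ τ _ he
    simp only [Prod.mk.injEq, true_and] at he
    ext i
    exact List.map_inj_left.1 he i (List.mem_finRange i)
  · rintro ⟨D, l⟩ hp
    rw [Finset.mem_coe, mem_marked] at hp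
    obtain ⟨h, hD⟩ := hp
    obtain rfl : D = [] := List.length_eq_zero_iff.1 hD
    have hlen : l.length = n := by simpa using h.length_add
    have hlt : ∀ x, x ∈ l → x < n := fun x hx => by simpa using (h.mem_iff x).2 (Or.inr hx)
    have hnd : l.Nodup := by simpa using h.nodup
    let f : Fin n → Fin n := fun i =>
      ⟨l[(i : ℕ)]'(by rw [hlen]; exact i.2), hlt _ (List.getElem_mem _)⟩
    have hf : Function.Injective f := by
      intro i j hij
      have : l[(i : ℕ)]'(by rw [hlen]; exact i.2) = l[(j : ℕ)]'(by rw [hlen]; exact j.2) :=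
        congrArg Fin.val hij
      exact Fin.ext ((hnd.getElem_inj_iff).1 this)
    let σ : Equiv.Perm (Fin n) := Equiv.ofBijective f (Finite.injective_iff_bijective.1 hf)
    have hσ : ((List.finRange n).map fun i => (σ i : ℕ)) = l := by
      apply List.ext_getElem
      · simp [hlen]
      · intro i h1 h2
        simp [σ, f]
    refine ⟨σ, ?_, by simp [hσ]⟩
    rw [Finset.mem_coe, Finset.mem_filter_univ, ← avoids_map_finRange_iff, hσ]
    simpa using h.avoids

/-! ### Factorial pairs as pairs of linear orders. -/

theorem exists_equiv_fin_of_strictTotalOrder {X : Type u} {n : ℕ} [Finite X]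
    (hX : Nat.card X = n) (r : X → X → Prop) (hirr : ∀ x, ¬ r x x)
    (htrans : ∀ x y z, r x y → r y z → r x z) (htot : ∀ x y, x ≠ y → r x y ∨ r y x) :
    ∃ e : X ≃ Fin n, ∀ x y, r x y ↔ e x < e y := by
  classical
  have := Fintype.ofFinite X
  rw [Nat.card_eq_fintype_card] at hX
  have hlt : ∀ x, (Finset.univ.filter fun y => r y x).card < n := by
    intro x
    rw [← hX, Finset.card_lt_iff_ne_univ]
    intro h
    have := Finset.mem_univ x
    rw [← h, Finset.mem_filter_univ] at this
    exact hirr x this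
  -- The rank of `x`: the number of elements below it.
  let f : X → Fin n := fun x => ⟨_, hlt x⟩
  have hmono : ∀ x y, r x y → f x < f y := by
    intro x y hxy
    rw [Fin.lt_def]
    refine Finset.card_lt_card ⟨fun z hz => ?_, fun h => ?_⟩
    · rw [Finset.mem_filter_univ] at hz ⊢
      exact htrans z x y hz hxy
    · have := h (Finset.mem_filter_univ _ |>.2 hxy)
      rw [Finset.mem_filter_univ] at this
      exact hirr x this
  have hinj : Function.Injective f := by
    intro x y hxy
    by_contra hne
    rcases htot x y hne with h | h
    · exact (hmono x y h).ne hxy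
    · exact (hmono y x h).ne hxy.symm
  refine ⟨Equiv.ofBijective f ((Fintype.bijective_iff_injective_and_card f).2
    ⟨hinj, by simp [hX]⟩), fun x y => ⟨hmono x y, fun h => ?_⟩⟩
  have hne : x ≠ y := by
    rintro rfl
    exact lt_irrefl _ h
  exact (htot x y hne).resolve_right fun h' => (lt_asymm h (hmono y x h')).elim

section Pairs

variable {X : Type u} {n : ℕ}

/-- The pairs of elements on which the positions `e` and the values `f` are ordered alike. -/
def ascentRel (e f : X ≃ Fin n) (x y : X) : Prop := e x < e y ∧ f x < f y

/-- The pairs of elements on which the positions `e` and the values `f` are ordered oppositely. -/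
def descentRel (e f : X ≃ Fin n) (x y : X) : Prop := e x < e y ∧ f y < f x

theorem ascentRel_or_descentRel (e f : X ≃ Fin n) (x y : X) :
    ascentRel e f x y ∨ descentRel e f x y ↔ e x < e y := by
  have : e x < e y → f x ≠ f y := fun h he => h.ne (congrArg e (f.injective he))
  unfold ascentRel descentRel
  constructor
  · tauto
  · intro h
    have := lt_or_gt_of_ne (this h)
    tauto

theorem ascentRel_or_descentRel_swap (e f : X ≃ Fin n) (x y : X) :
    ascentRel e f x y ∨ descentRel e f y x ↔ f x < f y := by
  have : f x < f y → e x ≠ e y := fun h he => h.ne (congrArg f (e.injective he))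
  unfold ascentRel descentRel
  constructor
  · tauto
  · intro h
    have := lt_or_gt_of_ne (this h)
    tauto

theorem isFactorialPair_ascentRel_descentRel (e f : X ≃ Fin n) :
    IsFactorialPair (ascentRel e f) (descentRel e f) where
  ord_S :=
    { irrefl := fun x h => lt_irrefl _ h.1
      trans := fun x y z h h' => ⟨h.1.trans h'.1, h.2.trans h'.2⟩ }
  ord_R :=
    { irrefl := fun x h => lt_irrefl _ h.1
      trans := fun x y z h h' => ⟨h.1.trans h'.1, h'.2.trans h.2⟩ }
  tot := fun x y => by
    have h1 := ascentRel_or_descentRel e f x y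
    have h2 := ascentRel_or_descentRel e f y x
    have h3 : x ≠ y ↔ e x < e y ∨ e y < e x := by rw [lt_or_lt_iff_ne, e.injective.ne_iff]
    unfold relSymm
    rw [h3]
    tauto
  inters := fun x y => by
    rintro ⟨h, h'⟩
    rcases h with h | h <;> rcases h' with h' | h'
    · exact lt_asymm h.2 h'.2
    · exact lt_asymm h.1 h'.1
    · exact lt_asymm h.1 h'.1
    · exact lt_asymm h.2 h'.2

/-- A chain `x S y S z R w` already puts `x` before `w`, so the composition condition only demands
that the value at `w` be below the value at `x`. -/
theorem isFPair_ascentRel_descentRel_iff (e f : X ≃ Fin n) :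
    IsFPair 2 1 (ascentRel e f) (descentRel e f) ↔ AvoidsPerm (e.symm.trans f) := by
  have hcomp : ∀ x w, Relation.Comp (relPow (ascentRel e f) 2) (relPow (descentRel e f) 1) x w ↔
      ∃ y z, ascentRel e f x y ∧ ascentRel e f y z ∧ descentRel e f z w := by
    intro x w
    simp only [relPow, Relation.Comp]
    constructor
    · rintro ⟨z, ⟨y, ⟨_, rfl, hxy⟩, hyz⟩, _, rfl, hzw⟩
      exact ⟨y, z, hxy, hyz, hzw⟩
    · rintro ⟨y, z, hxy, hyz, hzw⟩
      exact ⟨z, ⟨y, ⟨_, rfl, hxy⟩, hyz⟩, _, rfl, hzw⟩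
  constructor
  · rintro h i j k m hij hjk hkm h1 h2 h3
    have := h.comp (e.symm i) (e.symm m) ((hcomp _ _).2 ⟨e.symm j, e.symm k, ?_, ?_, ?_⟩)
    · exact this.2
    · exact ⟨by simpa using hij, h1⟩
    · exact ⟨by simpa using hjk, h2⟩
    · exact ⟨by simpa using hkm, h3⟩
  · intro h
    refine ⟨isFactorialPair_ascentRel_descentRel e f, fun x w hxw => ?_⟩
    obtain ⟨y, z, hxy, hyz, hzw⟩ := (hcomp x w).1 hxw
    refine ⟨hxy.1.trans (hyz.1.trans hzw.1), ?_⟩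
    have := h (e x) (e y) (e z) (e w) hxy.1 hyz.1 hzw.1
    simp only [Equiv.trans_apply, Equiv.symm_apply_apply] at this
    exact this hxy.2 hyz.2 hzw.2

/-- Through this symmetry `exists_equiv_fin` yields the order of values as well as that of
positions. -/
theorem IsFactorialPair.symm_right {S R : X → X → Prop} (h : IsFactorialPair S R) :
    IsFactorialPair S fun x y => R y x where
  ord_S := h.ord_S
  ord_R :=
    { irrefl := h.ord_R.irrefl
      trans := fun x y z hxy hyz => h.ord_R.trans z y x hyz hxy }
  tot := fun x y => by
    rw [← h.tot]
    simp only [relSymm, or_comm]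
  inters := fun x y hxy => h.inters x y ⟨hxy.1.symm, hxy.2⟩

theorem IsFactorialPair.not_both {S R : X → X → Prop} (h : IsFactorialPair S R) {x y : X}
    (hS : S x y ∨ S y x) (hR : R x y ∨ R y x) : False :=
  h.inters x y ⟨hR, hS⟩

theorem IsFactorialPair.exists_equiv_fin [Finite X] (hX : Nat.card X = n) {S R : X → X → Prop}
    (h : IsFactorialPair S R) : ∃ e : X ≃ Fin n, ∀ x y, S x y ∨ R x y ↔ e x < e y := by
  have hSt : ∀ {x y z}, S x y → S y z → S x z := fun {x y z} => h.ord_S.trans x y z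
  have hRt : ∀ {x y z}, R x y → R y z → R x z := fun {x y z} => h.ord_R.trans x y z
  have htot : ∀ x y, x ≠ y → (R x y ∨ R y x) ∨ S x y ∨ S y x := fun x y => (h.tot x y).2
  refine exists_equiv_fin_of_strictTotalOrder hX (fun x y => S x y ∨ R x y) ?_ ?_ ?_
  · rintro x (hx | hx)
    · exact h.ord_S.irrefl x hx
    · exact h.ord_R.irrefl x hx
  -- In the mixed cases `x` and `z` are comparable; if `z` came first, composing with one of the two
  -- given relations would relate `x` and `y`, or `y` and `z`, by both `S` and `R`.
  · rintro x y z (hxy | hxy) (hyz | hyz)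
    · exact Or.inl (hSt hxy hyz)
    · have hne : x ≠ z := by
        rintro rfl
        exact h.not_both (Or.inl hxy) (Or.inr hyz)
      rcases htot x z hne with (hR | hR) | hS | hS
      · exact Or.inr hR
      · exact (h.not_both (Or.inl hxy) (Or.inr (hRt hyz hR))).elim
      · exact Or.inl hS
      · exact (h.not_both (Or.inr (hSt hS hxy)) (Or.inl hyz)).elim
    · have hne : x ≠ z := by
        rintro rfl
        exact h.not_both (Or.inl hyz) (Or.inr hxy)
      rcases htot x z hne with (hR | hR) | hS | hS
      · exact Or.inr hR
      · exact (h.not_both (Or.inl hyz) (Or.inr (hRt hR hxy))).elim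
      · exact Or.inl hS
      · exact (h.not_both (Or.inr (hSt hyz hS)) (Or.inl hxy)).elim
    · exact Or.inr (hRt hxy hyz)
  · intro x y hxy
    rcases htot x y hxy with (hR | hR) | hS | hS
    · exact Or.inl (Or.inr hR)
    · exact Or.inr (Or.inr hR)
    · exact Or.inl (Or.inl hS)
    · exact Or.inr (Or.inl hS)

/-- Every factorial pair on a finite set comes from a pair of linear orders. -/
theorem IsFactorialPair.exists_ascentRel_descentRel [Finite X] (hX : Nat.card X = n)
    {S R : X → X → Prop} (h : IsFactorialPair S R) :
    ∃ e f : X ≃ Fin n, S = ascentRel e f ∧ R = descentRel e f := by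
  obtain ⟨e, he⟩ := h.exists_equiv_fin hX
  obtain ⟨f, hf⟩ := h.symm_right.exists_equiv_fin hX
  refine ⟨e, f, ?_, ?_⟩ <;> ext x y
  · rw [ascentRel, ← he, ← hf]
    refine ⟨fun hS => ⟨Or.inl hS, Or.inl hS⟩, ?_⟩
    rintro ⟨hS | hR, hS' | hR'⟩
    · exact hS
    · exact hS
    · exact hS'
    · exact (h.ord_R.irrefl x (h.ord_R.trans x y x hR hR')).elim
  · rw [descentRel, ← he, ← hf]
    refine ⟨fun hR => ⟨Or.inr hR, Or.inr hR⟩, ?_⟩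
    rintro ⟨hS | hR, hS' | hR'⟩
    · exact (h.ord_S.irrefl x (h.ord_S.trans x y x hS hS')).elim
    · exact hR'
    · exact hR
    · exact hR

theorem Equiv.eq_refl_of_lt_iff_lt {g : Fin n ≃ Fin n} (hg : ∀ i j, i < j ↔ g i < g j) :
    g = Equiv.refl _ := by
  have : (⟨g, fun {i j} => by rw [← not_lt, ← not_lt, hg j i]⟩ : Fin n ≃o Fin n) =
      OrderIso.refl _ := Subsingleton.elim _ _
  ext i
  exact congrArg (fun φ : Fin n ≃o Fin n => (φ i : ℕ)) this

/-- An isomorphism preserves both linear orders, since these are recovered from the two relations,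
and `Fin n` has no order automorphism but the identity. -/
theorem pairIso_ascentRel_descentRel_iff (e f e' f' : X ≃ Fin n) :
    PairIso (ascentRel e f) (descentRel e f) (ascentRel e' f') (descentRel e' f') ↔
      e.symm.trans f = e'.symm.trans f' := by
  constructor
  · rintro ⟨g, hS, hR⟩
    have he : ∀ x y, e x < e y ↔ e' (g x) < e' (g y) := fun x y => by
      rw [← ascentRel_or_descentRel e f, ← ascentRel_or_descentRel e' f', hS, hR]
    have hf : ∀ x y, f x < f y ↔ f' (g x) < f' (g y) := fun x y => by
      rw [← ascentRel_or_descentRel_swap e f, ← ascentRel_or_descentRel_swap e' f', hS, hR]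
    have h1 := Equiv.eq_refl_of_lt_iff_lt (g := (e.symm.trans g).trans e') fun i j => by
      have := he (e.symm i) (e.symm j)
      simpa using this
    have h2 := Equiv.eq_refl_of_lt_iff_lt (g := (f.symm.trans g).trans f') fun i j => by
      have := hf (f.symm i) (f.symm j)
      simpa using this
    ext i
    have h3 : e' (g (e.symm i)) = i := Equiv.congr_fun h1 i
    have h4 : f' (g (e.symm i)) = f (e.symm i) := by
      simpa using Equiv.congr_fun h2 (f (e.symm i))
    rw [Equiv.trans_apply, Equiv.trans_apply, ← h4]
    congr 2
    rw [Equiv.eq_symm_apply, h3]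
  · intro h
    have hf : ∀ x, f' (e'.symm (e x)) = f x := fun x => by
      have := Equiv.congr_fun h (e x)
      simpa using this.symm
    exact ⟨e.trans e'.symm, fun x y => by simp [ascentRel, hf],
      fun x y => by simp [descentRel, hf]⟩

theorem card_fPairClass [Finite X] (hX : Nat.card X = n) :
    Nat.card (FPairClass 2 1 X) = Nat.card {σ : Equiv.Perm (Fin n) // AvoidsPerm σ} := by
  -- An arbitrary labelling serves as the position order: each class has a representative with these
  -- positions.
  let e : X ≃ Fin n := Finite.equivFinOfCardEq hX
  have hσ : ∀ σ : Equiv.Perm (Fin n), e.symm.trans (e.trans σ) = σ := fun σ => by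
    ext
    simp
  let F : {σ : Equiv.Perm (Fin n) // AvoidsPerm σ} → FPair 2 1 X := fun σ =>
    ⟨(ascentRel e (e.trans σ.1), descentRel e (e.trans σ.1)),
      (isFPair_ascentRel_descentRel_iff _ _).2 (by rw [hσ]; exact σ.2)⟩
  symm
  refine Nat.card_eq_of_bijective
    (fun σ => (Quotient.mk (FPair.isoSetoid 2 1 X) (F σ) : FPairClass 2 1 X)) ⟨?_, ?_⟩
  · intro σ τ hστ
    have := (pairIso_ascentRel_descentRel_iff e (e.trans σ.1) e (e.trans τ.1)).1
      (Quotient.exact hστ)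
    rw [hσ, hσ] at this
    exact Subtype.ext this
  · intro q
    induction q using Quotient.inductionOn with
    | _ p =>
      obtain ⟨⟨S, R⟩, hp⟩ := p
      obtain ⟨e', f', hS, hR⟩ := hp.toIsFactorialPair.exists_ascentRel_descentRel hX
      dsimp only at hp hS hR
      subst hS hR
      refine ⟨⟨e'.symm.trans f', (isFPair_ascentRel_descentRel_iff _ _).1 hp⟩, ?_⟩
      exact Quotient.sound ((pairIso_ascentRel_descentRel_iff _ _ _ _).2 (hσ _))

end Pairs

theorem mainTheorem11 (n : ℕ) (hn : 1 ≤ n) (X : Type u) (hX : Nat.card X = n) :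
    Nat.card (FPairClass 2 1 X) = Nat.largeSchroder (n - 1) := by
  have : Finite X := Nat.finite_of_card_ne_zero (by omega)
  rw [card_fPairClass hX, card_avoidsPerm, card_marked_range_zero hn]
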